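/- Let $n\ge 1$ and $W^T:\mathbb{R}^n\to\mathbb{C}$, and put $G_\alpha(y)=W^T(y)\,(1+|y|^2)^{-\alpha/2}$ for $\alpha\in\mathbb{R}$. Let $\alpha_{\inf}\in\mathbb{R}$ be such that $G_\beta\in L^1(\mathbb{R}^n)$ for all $\beta>\alpha_{\inf}$ and $G_\beta\notin L^1(\mathbb{R}^n)$ for all $\beta<\alpha_{\inf}$. Let $\alpha\in\mathbb{R}$, $\varepsilon:=\alpha_{\inf}-\alpha$ with $0\le\varepsilon<n$, and assume that $G_\alpha$ has a tail of the form $|y|^{-(n-\varepsilon)}$, that is, $G_\alpha(y)\sim c\,|y|^{-(n-\varepsilon)}$ as $|y|\to\infty$ for some constant $c\neq 0$. Then $G_\alpha$ defines a tempered distribution by $\varphi\mapsto\int G_\alpha\varphi\,dy$ (the integral converging absolutely for every $\varphi\in\mathcal{S}(\mathbb{R}^n)$), and its distributional Fourier transform $\hat G_\alpha$ has the following behavior near $p=0$, where $\langle u(\lambda\,\cdot),\varphi\rangle:=\lambda^{-n}\langle u,\varphi(\cdot/\lambda)\rangle$ for $\lambda>0$. (i) If $\varepsilon>0$, then $\hat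 G_\alpha(p)\sim C|p|^{-\varepsilon}$ near $p=0$ as a distribution: there is a constant $C\neq 0$ such that for every $\varphi\in\mathcal{S}(\mathbb{R}^n)$ $$\lim_{\lambda\to 0^+}\lambda^{\varepsilon}\,\langle\hat G_\alpha(\lambda\,\cdot),\varphi\rangle=C\int_{\mathbb{R}^n}|p|^{-\varepsilon}\varphi(p)\,dp .$$ (ii) If $\varepsilon=0$, that is, $\alpha=\alpha_{\inf}$, the singularity is logarithmic, $\hat G_\alpha(p)\sim -C\log|p|$ near $p=0$ as a distribution: there is a constant $C\neq 0$ such that for every $\varphi\in\mathcal{S}(\mathbb{R}^n)$ $$\lim_{\lambda\to 0^+}\frac{\langle\hat G_\alpha(\lambda\,\cdot),\varphi\rangle}{\log(1/\lambda)}=C\int_{\mathbb{R}^n}\varphi(p)\,dp ,$$ and for every $\varphi\in\mathcal{S}(\mathbb{R}^n)$ with $\int\varphi\,dp=0$ $$\lim_{\lambda\to 0^+}\langle\hat G_\alpha(\lambda\,\cdot),\varphi\rangle=-C\int_{\mathbb{R}^n}\log|p|\;\varphi(p)\,dp .$$ -/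

import Mathlib

open MeasureTheory Filter Asymptotics
open scoped Topology SchwartzMap FourierTransform

noncomputable section

/-- The damped two-point function `G_α(y) = W(y) (1 + |y|²)^(-α/2)`. -/
def dampedG {n : ℕ} (W : EuclideanSpace ℝ (Fin n) → ℂ) (α : ℝ) (y : EuclideanSpace ℝ (Fin n)) : ℂ :=
  W y * (((1 + ‖y‖ ^ 2) ^ (-α / 2) : ℝ) : ℂ)

/-- `a` is the integrability threshold `α_inf` of `W`: `G_α` is in `L¹` for `α > a` and is not in
`L¹` for `α < a`. -/
def IsAlphaInf {n : ℕ} (W : EuclideanSpace ℝ (Fin n) → ℂ) (a : ℝ) : Prop :=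
  (∀ α, a < α → Integrable (dampedG W α)) ∧ (∀ α, α < a → ¬ Integrable (dampedG W α))

/-- `g` has a tail of the form `|y|^(-s)`: `g(y) ~ c |y|^(-s)` as `|y| → ∞`, for some `c ≠ 0`. -/
def HasPowerTail {n : ℕ} (g : EuclideanSpace ℝ (Fin n) → ℂ) (s : ℝ) : Prop :=
  ∃ c : ℂ, c ≠ 0 ∧
    g ~[cocompact (EuclideanSpace ℝ (Fin n))] fun y => c * ((‖y‖ ^ (-s) : ℝ) : ℂ)

/-- The tempered distribution `T` is the one given by the function `g`. -/
def IsRepresentedBy {n : ℕ} (T : 𝓢'(EuclideanSpace ℝ (Fin n), ℂ))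
    (g : EuclideanSpace ℝ (Fin n) → ℂ) : Prop :=
  ∀ φ : 𝓢(EuclideanSpace ℝ (Fin n), ℂ),
    Integrable (fun y => g y * φ y) ∧ T φ = ∫ y, g y * φ y

/-- The Schwartz function `p ↦ φ(p / l)` for `l ≠ 0` (and `0` for `l = 0`, a value never used). -/
def stretch {n : ℕ} (l : ℝ) (φ : 𝓢(EuclideanSpace ℝ (Fin n), ℂ)) :
    𝓢(EuclideanSpace ℝ (Fin n), ℂ) :=
  if h : l ≠ 0 then
    SchwartzMap.compCLMOfContinuousLinearEquiv ℂ
      (ContinuousLinearEquiv.smulLeft (R₁ := ℝ) (M₁ := EuclideanSpace ℝ (Fin n))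
        (Units.mk0 l h)⁻¹) φ
  else 0

theorem stretch_apply {n : ℕ} {l : ℝ} (h : l ≠ 0) (φ : 𝓢(EuclideanSpace ℝ (Fin n), ℂ))
    (p : EuclideanSpace ℝ (Fin n)) : stretch l φ p = φ (l⁻¹ • p) := by
  simp only [stretch, dif_pos h]
  rfl

/-- The rescaled distribution `u(l ·)`, `l > 0`, smeared with `φ`:
`∫ u(l p) φ(p) dp = l^(-n) ∫ u(p) φ(p / l) dp`. -/
def rescaled {n : ℕ} (u : 𝓢'(EuclideanSpace ℝ (Fin n), ℂ)) (l : ℝ)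
    (φ : 𝓢(EuclideanSpace ℝ (Fin n), ℂ)) : ℂ :=
  (((l ^ n)⁻¹ : ℝ) : ℂ) * u (stretch l φ)

/-- `u(p) ~ C |p|^(-ε)` near `p = 0` in the sense of distributions, with `C ≠ 0`:
`l^ε u(l p) → C |p|^(-ε)` as `l → 0+`, smeared with any test function. -/
def HasPowerSingularity {n : ℕ} (u : 𝓢'(EuclideanSpace ℝ (Fin n), ℂ)) (ε : ℝ) : Prop :=
  ∃ C : ℂ, C ≠ 0 ∧ ∀ φ : 𝓢(EuclideanSpace ℝ (Fin n), ℂ),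
    Tendsto (fun l : ℝ => ((l ^ ε : ℝ) : ℂ) * rescaled u l φ) (𝓝[>] 0)
      (𝓝 (C * ∫ p, ((‖p‖ ^ (-ε) : ℝ) : ℂ) * φ p))

/-- `u(p) ~ -C log |p|` near `p = 0` in the sense of distributions, with `C ≠ 0`:
as `l → 0+`, `u(l p) / log (1 / l) → C` smeared with any test function, and
`u(l p) → -C log |p|` modulo constants, that is, smeared with any test function of integral `0`. -/
def HasLogSingularity {n : ℕ} (u : 𝓢'(EuclideanSpace ℝ (Fin n), ℂ)) : Prop :=
  ∃ C : ℂ, C ≠ 0 ∧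
    (∀ φ : 𝓢(EuclideanSpace ℝ (Fin n), ℂ),
      Tendsto (fun l : ℝ => rescaled u l φ / ((Real.log (1 / l) : ℝ) : ℂ)) (𝓝[>] 0)
        (𝓝 (C * ∫ p, φ p))) ∧
    (∀ φ : 𝓢(EuclideanSpace ℝ (Fin n), ℂ), (∫ p, φ p) = 0 →
      Tendsto (fun l : ℝ => rescaled u l φ) (𝓝[>] 0)
        (𝓝 (-C * ∫ p, ((Real.log ‖p‖ : ℝ) : ℂ) * φ p)))

end

/-! Rescaling commutes with the Fourier transform: `⟨𝓕 T (l ·), φ⟩ = ∫ G(y) 𝓕φ(l y) dy`, so the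
limit `l → 0+` only sees the tail of `G` (`rescaled_fourier`). With `x = l y` and `h = 𝓕φ`, `l^ε`
times this integral is `∫ l^(-(n-ε)) G(x/l) h(x) dx`, which tends to `c ∫ |x|^(-(n-ε)) h(x) dx`. A
bounded region of `y` contributes `O(l^(ε+δ))` when `h = O(|x|^δ)`
(`tendsto_rpow_mul_integral_comp_smul`).

For `ε > 0`, `δ = 0` suffices, and the limit is evaluated by the Fourier transform of a Riesz kernel
(`integral_norm_rpow_mul_fourier`), found by writing powers as superpositions of Gaussians.

For `ε = 0` some vanishing at the origin is needed, so `h(0)` times the indicator of the unit ball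
is subtracted from `h`. The remainder converges by the scaling limit with `δ = 1`. The subtracted
part is `h(0) ∫_{|y|<1/l} G`, which grows like `c σ h(0) log(1/l)`, with `σ` the area of the unit
sphere (`tendsto_setIntegral_ball_div_log`). If `∫ φ = h(0) = 0`, only the convergent part remains;
its limit is the `ε → 0+` limit of the Riesz formula, where the constant behaves like `σ/ε` and
`(|p|^(-ε) - 1)/ε → -log |p|` (`integral_norm_rpow_neg_finrank_mul_fourier`). -/

/-! ### Integrability of powers against Schwartz functions -/

section Integrability

variable {E : Type*} [NormedAddCommGroup E]

theorem measurable_norm_rpow [MeasurableSpace E] [BorelSpace E] (a : ℝ) :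
    Measurable fun x : E => ((‖x‖ ^ a : ℝ) : ℂ) :=
  Complex.measurable_ofReal.comp (measurable_norm.pow_const a)

variable [InnerProductSpace ℝ E]

/-- One constant serves both the sup bound and the decay, as the integrability criterion below
requires. A real exponent is dominated by a natural one because `‖x‖ ≥ 1`. -/
theorem SchwartzMap.norm_rpow_mul_norm_le (f : 𝓢(E, ℂ)) (b : ℝ) :
    ∃ K, 0 ≤ K ∧ (∀ x, ‖f x‖ ≤ K) ∧ ∀ x, 1 ≤ ‖x‖ → ‖f x‖ ≤ K * ‖x‖ ^ (-b) := by
  obtain ⟨k, hk⟩ := exists_nat_ge b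
  refine ⟨SchwartzMap.seminorm ℝ 0 0 f + SchwartzMap.seminorm ℝ k 0 f, by positivity,
    fun x => ?_, fun x hx => ?_⟩
  · have := f.norm_le_seminorm ℝ x
    have : 0 ≤ SchwartzMap.seminorm ℝ k 0 f := by positivity
    linarith
  · have h1 := f.norm_pow_mul_le_seminorm ℝ k x
    have h2 : 0 ≤ SchwartzMap.seminorm ℝ 0 0 f := by positivity
    have hx0 : 0 < ‖x‖ := by linarith
    rw [Real.rpow_neg hx0.le, ← div_eq_mul_inv, le_div_iff₀ (by positivity)]
    have h3 : ‖x‖ ^ b ≤ ‖x‖ ^ k := by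
      rw [← Real.rpow_natCast]; exact Real.rpow_le_rpow_of_exponent_le hx hk
    nlinarith [norm_nonneg (f x)]

variable [FiniteDimensional ℝ E] [MeasurableSpace E] [BorelSpace E] [Nontrivial E]

/-- A function bounded by an integrable power near the origin and by an integrable power at
infinity is integrable. -/
theorem integrable_of_norm_le_rpow_of_norm_le_rpow {f : E → ℂ} (hf : AEStronglyMeasurable f)
    {K a b : ℝ} (ha : a < Module.finrank ℝ E) (hb : Module.finrank ℝ E < b)
    (h0 : ∀ x, 0 < ‖x‖ → ‖x‖ < 1 → ‖f x‖ ≤ K * ‖x‖ ^ (-a))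
    (h1 : ∀ x, 1 ≤ ‖x‖ → ‖f x‖ ≤ K * ‖x‖ ^ (-b)) : Integrable f := by
  have hd : 1 ≤ Module.finrank ℝ E := Module.finrank_pos
  set m : ℝ → ℝ := fun r => if r < 1 then r ^ (-a) else r ^ (-b) with hm
  have hmint : Integrable (fun x : E => m ‖x‖) := by
    -- Polar coordinates reduce the claim to powers of `r` on `(0, 1)` and `(1, ∞)`.
    rw [integrable_fun_norm_addHaar volume (f := m)]
    rw [← Set.Ioo_union_Ici_eq_Ioi (zero_lt_one' ℝ), integrableOn_union]
    constructor
    · have : IntegrableOn (fun y : ℝ => y ^ (((Module.finrank ℝ E : ℝ) - 1) - a)) (Set.Ioo 0 1) := by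
        rw [intervalIntegral.integrableOn_Ioo_rpow_iff zero_lt_one]; linarith
      refine this.congr_fun (fun y hy => ?_) measurableSet_Ioo
      simp only [hm, if_pos hy.2, smul_eq_mul]
      rw [← Real.rpow_natCast, ← Real.rpow_add hy.1]
      congr 1
      push_cast [hd]
      ring
    · rw [integrableOn_Ici_iff_integrableOn_Ioi]
      have : IntegrableOn (fun y : ℝ => y ^ (((Module.finrank ℝ E : ℝ) - 1) - b)) (Set.Ioi 1) := by
        rw [integrableOn_Ioi_rpow_iff zero_lt_one]; linarith
      refine this.congr_fun (fun y hy => ?_) measurableSet_Ioi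
      have hy' : (1 : ℝ) < y := hy
      simp only [hm, if_neg hy'.not_gt, smul_eq_mul]
      rw [← Real.rpow_natCast, ← Real.rpow_add (by linarith)]
      congr 1
      push_cast [hd]
      ring
  refine (hmint.const_mul K).mono' hf ?_
  filter_upwards [Measure.ae_ne volume (0 : E)] with x hx
  by_cases hx1 : ‖x‖ < 1
  · simpa [hm, hx1] using h0 x (norm_pos_iff.2 hx) hx1
  · simpa [hm, hx1] using h1 x (not_lt.1 hx1)

/-- Schwartz functions are integrable against `‖x‖ ^ (-a)` for `a` below the dimension. -/
theorem SchwartzMap.integrable_norm_rpow_mul (f : 𝓢(E, ℂ)) {a : ℝ}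
    (ha : a < Module.finrank ℝ E) :
    Integrable fun x => ((‖x‖ ^ (-a) : ℝ) : ℂ) * f x := by
  obtain ⟨K, hK, hK0, hK1⟩ := f.norm_rpow_mul_norm_le (Module.finrank ℝ E + 1 - a)
  refine integrable_of_norm_le_rpow_of_norm_le_rpow (K := K)
    ((measurable_norm_rpow _).aestronglyMeasurable.mul f.continuous.aestronglyMeasurable) ha
    (b := Module.finrank ℝ E + 1) (by linarith) (fun x hx _ => ?_) (fun x hx => ?_)
  · rw [norm_mul, Complex.norm_real, Real.norm_of_nonneg (by positivity), mul_comm]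
    exact mul_le_mul_of_nonneg_right (hK0 x) (by positivity)
  · rw [norm_mul, Complex.norm_real, Real.norm_of_nonneg (by positivity)]
    refine (mul_le_mul_of_nonneg_left (hK1 x hx) (by positivity)).trans_eq ?_
    rw [mul_left_comm, ← Real.rpow_add (by linarith)]
    congr 2; ring

end Integrability

/-! ### Rescaling on the Fourier side; temperedness of `dampedG` -/

/-- The Fourier transform of `φ(· / l)` is `l^n 𝓕φ(l ·)`, and `l^n` cancels the normalisation of
`rescaled`. -/
theorem rescaled_fourier {n : ℕ} {T : 𝓢'(EuclideanSpace ℝ (Fin n), ℂ)}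
    {g : EuclideanSpace ℝ (Fin n) → ℂ} (hT : IsRepresentedBy T g) {l : ℝ} (hl : 0 < l)
    (φ : 𝓢(EuclideanSpace ℝ (Fin n), ℂ)) :
    rescaled (𝓕 T) l φ = ∫ y, g y * 𝓕 φ (l • y) := by
  have key : ∀ y, 𝓕 (stretch l φ) y = ((l ^ n : ℝ) : ℂ) * 𝓕 φ (l • y) := by
    intro y
    rw [SchwartzMap.fourier_coe, SchwartzMap.fourier_coe, Real.fourier_eq, Real.fourier_eq]
    have := Measure.integral_comp_inv_smul_of_nonneg (volume : Measure (EuclideanSpace ℝ (Fin n)))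
      (fun v => Real.fourierChar (-inner ℝ v (l • y)) • φ v) hl.le
    rw [finrank_euclideanSpace_fin] at this
    rw [← Complex.real_smul, ← this]
    congr 1
    ext v
    rw [stretch_apply hl.ne']
    congr 3
    rw [inner_smul_left, inner_smul_right]
    simp [hl.ne']
  rw [rescaled, TemperedDistribution.fourier_apply, (hT _).2, ← integral_const_mul]
  congr 1
  ext y
  rw [key]
  have : ((l : ℂ)) ^ n ≠ 0 := by simp [hl.ne']
  push_cast
  field_simp

theorem dampedG_eq_mul {n : ℕ} (W : EuclideanSpace ℝ (Fin n) → ℂ) (α β : ℝ)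
    (y : EuclideanSpace ℝ (Fin n)) :
    dampedG W α y = dampedG W β y * (((1 + ‖y‖ ^ 2) ^ ((β - α) / 2) : ℝ) : ℂ) := by
  have : (0 : ℝ) < 1 + ‖y‖ ^ 2 := by positivity
  rw [dampedG, dampedG, mul_assoc, ← Complex.ofReal_mul, ← Real.rpow_add this]
  congr 4; ring

/-- A function that becomes integrable after damping defines a tempered distribution. -/
theorem exists_isRepresentedBy_dampedG {n : ℕ} {W : EuclideanSpace ℝ (Fin n) → ℂ} {β : ℝ}
    (hβ : Integrable (dampedG W β)) (α : ℝ) :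
    ∃ T : 𝓢'(EuclideanSpace ℝ (Fin n), ℂ), IsRepresentedBy T (dampedG W α) := by
  have : Fact ((1 : ENNReal) ≤ 1) := ⟨le_rfl⟩
  set w : EuclideanSpace ℝ (Fin n) → ℂ := fun y => (((1 + ‖y‖ ^ 2) ^ ((β - α) / 2) : ℝ) : ℂ)
    with hw
  have hwt : w.HasTemperateGrowth :=
    Function.Complex.hasTemperateGrowth_ofReal.comp
      (Function.hasTemperateGrowth_one_add_norm_sq_rpow _ ((β - α) / 2))
  set L := (memLp_one_iff_integrable.2 hβ).toLp (dampedG W β)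
  have hL : L =ᵐ[volume] dampedG W β := MemLp.coeFn_toLp _
  -- `T` is the distribution of an `L¹` function, multiplied by a smooth weight of temperate growth
  -- that undoes the extra damping.
  refine ⟨TemperedDistribution.smulLeftCLM ℂ w (Lp.toTemperedDistribution L), fun φ => ⟨?_, ?_⟩⟩
  · set ψ := SchwartzMap.smulLeftCLM ℂ w φ
    have h1 : Integrable fun y => dampedG W β y * ψ y :=
      hβ.mul_bdd ψ.continuous.aestronglyMeasurable
        (ae_of_all _ fun y => ψ.norm_le_seminorm ℝ y)
    refine h1.congr (ae_of_all _ fun y => ?_)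
    simp only [ψ, SchwartzMap.smulLeftCLM_apply_apply hwt, smul_eq_mul]
    rw [dampedG_eq_mul W α β y]; simp only [hw]; ring
  · rw [TemperedDistribution.smulLeftCLM_apply_apply, Lp.toTemperedDistribution_apply]
    refine integral_congr_ae ?_
    filter_upwards [hL] with y hy
    rw [hy, SchwartzMap.smulLeftCLM_apply_apply hwt, smul_eq_mul, smul_eq_mul,
      dampedG_eq_mul W α β y]; simp only [hw]; ring

theorem locallyIntegrable_dampedG {n : ℕ} {W : EuclideanSpace ℝ (Fin n) → ℂ} {β : ℝ}
    (hβ : Integrable (dampedG W β)) (α : ℝ) : LocallyIntegrable (dampedG W α) := by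
  have h : dampedG W α =
      fun y => dampedG W β y * (((1 + ‖y‖ ^ 2) ^ ((β - α) / 2) : ℝ) : ℂ) :=
    funext (dampedG_eq_mul W α β)
  rw [h]
  refine hβ.locallyIntegrable.mul_continuous ?_
  refine Complex.continuous_ofReal.comp (Continuous.rpow_const (by fun_prop) fun y => Or.inl ?_)
  positivity

/-! ### Fourier transform of Riesz kernels -/

section Riesz

variable {E : Type*} [NormedAddCommGroup E] [InnerProductSpace ℝ E] [FiniteDimensional ℝ E]
  [MeasurableSpace E] [BorelSpace E]

/-- Self-adjointness of the Fourier transform, applied to a Gaussian, whose transform has the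
parameter `t` inverted. -/
theorem integral_gaussian_mul_fourier (φ : 𝓢(E, ℂ)) {t : ℝ} (ht : 0 < t) :
    ∫ x, ((Real.exp (-(Real.pi * ‖x‖ ^ 2 * t)) : ℝ) : ℂ) * 𝓕 φ x =
      ((t ^ (-(Module.finrank ℝ E : ℝ) / 2) : ℝ) : ℂ) *
        ∫ p, ((Real.exp (-(Real.pi * ‖p‖ ^ 2 * t⁻¹)) : ℝ) : ℂ) * φ p := by
  have hb : 0 < ((Real.pi * t : ℝ) : ℂ).re := by simpa using by positivity
  have hgint : Integrable fun v : E => Complex.exp (-((Real.pi * t : ℝ) : ℂ) * ‖v‖ ^ 2) := by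
    simpa using GaussianFourier.integrable_cexp_neg_mul_sq_norm_add hb 0 (0 : E)
  have h := VectorFourier.integral_fourierIntegral_smul_eq_flip (L := innerₗ E)
    Real.continuous_fourierChar continuous_inner hgint (φ.integrable (μ := volume))
  have e1 : ∀ ξ, VectorFourier.fourierIntegral Real.fourierChar volume (innerₗ E)
      (fun v : E => Complex.exp (-((Real.pi * t : ℝ) : ℂ) * ‖v‖ ^ 2)) ξ =
      ((t ^ (-(Module.finrank ℝ E : ℝ) / 2) : ℝ) : ℂ) *
        ((Real.exp (-(Real.pi * ‖ξ‖ ^ 2 * t⁻¹)) : ℝ) : ℂ) := by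
    intro ξ
    refine (fourier_gaussian_innerProductSpace hb ξ).trans ?_
    have hpi : (Real.pi : ℂ) ≠ 0 := by simp
    have htc : (t : ℂ) ≠ 0 := by exact_mod_cast ht.ne'
    congr 1
    · rw [neg_div, Real.rpow_neg ht.le, ← Real.inv_rpow ht.le,
        Complex.ofReal_cpow (by positivity)]
      congr 1
      · push_cast; field_simp
      · push_cast; ring
    · push_cast
      congr 1
      field_simp
  have e2 : ∀ x, VectorFourier.fourierIntegral Real.fourierChar volume (innerₗ E).flip φ x =
      𝓕 φ x := by
    intro x
    rw [flip_innerₗ]; rfl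
  simp only [e1, e2, smul_eq_mul] at h
  rw [← integral_const_mul]
  calc _ = ∫ x, Complex.exp (-((Real.pi * t : ℝ) : ℂ) * ‖x‖ ^ 2) * 𝓕 φ x := by
        congr 1; ext x; congr 1; push_cast; congr 1; ring
    _ = _ := by rw [← h]; congr 1; ext x; ring

variable [Nontrivial E]

theorem integral_rpow_mul_exp_neg_pi_mul_norm_sq {F : Type*} [NormedAddCommGroup F] {a : ℝ}
    (ha : 0 < a) {x : F} (hx : x ≠ 0) :
    ∫ t in Set.Ioi (0 : ℝ), t ^ (a / 2 - 1) * Real.exp (-(Real.pi * ‖x‖ ^ 2 * t)) =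
      Real.pi ^ (-(a / 2)) * Real.Gamma (a / 2) * ‖x‖ ^ (-a) := by
  have hx' := norm_pos_iff.2 hx
  have hpi := Real.pi_pos
  rw [Real.integral_rpow_mul_exp_neg_mul_Ioi (by positivity) (by positivity), one_div,
    Real.inv_rpow (by positivity), Real.mul_rpow (by positivity) (by positivity),
    ← Real.rpow_natCast, ← Real.rpow_mul hx'.le, Real.rpow_neg (by positivity),
    Real.rpow_neg (by positivity)]
  have : ((2 : ℕ) : ℝ) * (a / 2) = a := by push_cast; ring
  rw [this]
  field_simp

theorem integrableOn_rpow_mul_exp_neg_pi_mul_norm_sq {F : Type*} [NormedAddCommGroup F] {a : ℝ}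
    (ha : 0 < a) {x : F} (hx : x ≠ 0) :
    IntegrableOn (fun t : ℝ => t ^ (a / 2 - 1) * Real.exp (-(Real.pi * ‖x‖ ^ 2 * t)))
      (Set.Ioi 0) := by
  have hx' := norm_pos_iff.2 hx
  have hpi := Real.pi_pos
  -- The integral of a non-integrable function is `0` by convention, so a nonzero value proves
  -- integrability.
  refine Integrable.of_integral_ne_zero ?_
  rw [integral_rpow_mul_exp_neg_pi_mul_norm_sq ha hx]
  have := Real.Gamma_pos_of_pos (half_pos ha)
  positivity

/-- Pairing with `‖x‖ ^ (-a)` as a superposition of pairings with Gaussians. -/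
theorem integral_rpow_mul_integral_gaussian {f : E → ℂ} {a : ℝ} (ha : 0 < a)
    (hf : AEStronglyMeasurable f)
    (hfa : Integrable fun x => ((‖x‖ ^ (-a) : ℝ) : ℂ) * f x) :
    ∫ t in Set.Ioi (0 : ℝ), ((t ^ (a / 2 - 1) : ℝ) : ℂ) *
        ∫ x, ((Real.exp (-(Real.pi * ‖x‖ ^ 2 * t)) : ℝ) : ℂ) * f x =
      ((Real.pi ^ (-(a / 2)) * Real.Gamma (a / 2) : ℝ) : ℂ) *
        ∫ x, ((‖x‖ ^ (-a) : ℝ) : ℂ) * f x := by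
  set k : E → ℝ → ℂ := fun x t =>
    ((t ^ (a / 2 - 1) * Real.exp (-(Real.pi * ‖x‖ ^ 2 * t)) : ℝ) : ℂ) * f x with hk
  have hmeas : AEStronglyMeasurable (Function.uncurry k)
      (volume.prod (volume.restrict (Set.Ioi (0 : ℝ)))) := by
    refine AEStronglyMeasurable.mul (Measurable.aestronglyMeasurable ?_) hf.comp_fst
    exact Complex.measurable_ofReal.comp (by fun_prop)
  have hint : Integrable (Function.uncurry k)
      (volume.prod (volume.restrict (Set.Ioi (0 : ℝ)))) := by
    rw [integrable_prod_iff hmeas]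
    constructor
    · filter_upwards [Measure.ae_ne volume (0 : E)] with x hx
      exact ((integrableOn_rpow_mul_exp_neg_pi_mul_norm_sq ha hx).ofReal (𝕜 := ℂ)).mul_const (f x)
    · refine ((hfa.norm.const_mul (Real.pi ^ (-(a / 2)) * Real.Gamma (a / 2)))).congr ?_
      filter_upwards [Measure.ae_ne volume (0 : E)] with x hx
      have h1 : ∀ t ∈ Set.Ioi (0 : ℝ), ‖Function.uncurry k (x, t)‖ =
          (t ^ (a / 2 - 1) * Real.exp (-(Real.pi * ‖x‖ ^ 2 * t))) * ‖f x‖ := by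
        intro t ht
        have ht' : (0 : ℝ) < t := ht
        simp only [hk, Function.uncurry, norm_mul, Complex.norm_real]
        rw [Real.norm_of_nonneg (by positivity), Real.norm_of_nonneg (by positivity)]
      rw [setIntegral_congr_fun measurableSet_Ioi h1, integral_mul_const,
        integral_rpow_mul_exp_neg_pi_mul_norm_sq ha hx, norm_mul, Complex.norm_real,
        Real.norm_of_nonneg (by positivity)]
      ring
  have hswap := integral_integral_swap hint
  have hL : ∫ x, ∫ t in Set.Ioi (0 : ℝ), k x t =
      ((Real.pi ^ (-(a / 2)) * Real.Gamma (a / 2) : ℝ) : ℂ) *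
        ∫ x, ((‖x‖ ^ (-a) : ℝ) : ℂ) * f x := by
    rw [← integral_const_mul]
    refine integral_congr_ae ?_
    filter_upwards [Measure.ae_ne volume (0 : E)] with x hx
    simp only [hk]
    rw [integral_mul_const, integral_complex_ofReal,
      integral_rpow_mul_exp_neg_pi_mul_norm_sq ha hx]
    push_cast; ring
  rw [← hL, hswap]
  refine setIntegral_congr_fun measurableSet_Ioi fun t _ => ?_
  simp only [hk]
  rw [← integral_const_mul]
  congr 1
  ext x
  push_cast; ring

/-- The constant in the Fourier transform of `‖x‖ ^ (-(d - ε))`. -/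
noncomputable def rieszConst (d ε : ℝ) : ℝ :=
  Real.pi ^ ((d - ε) / 2) / Real.Gamma ((d - ε) / 2) *
    (Real.pi ^ (-(ε / 2)) * Real.Gamma (ε / 2))

theorem rieszConst_pos {d ε : ℝ} (hε : 0 < ε) (hd : ε < d) : 0 < rieszConst d ε := by
  have h1 := Real.Gamma_pos_of_pos (half_pos hε)
  have h2 := Real.Gamma_pos_of_pos (half_pos (sub_pos.2 hd))
  have := Real.pi_pos
  unfold rieszConst
  positivity

/-- The Fourier transform of `‖x‖ ^ (-(d - ε))` is a multiple of `‖p‖ ^ (-ε)`. -/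
theorem integral_norm_rpow_mul_fourier (φ : 𝓢(E, ℂ)) {d ε : ℝ}
    (hdE : (Module.finrank ℝ E : ℝ) = d) (hε : 0 < ε) (hd : ε < d) :
    ∫ x, ((‖x‖ ^ (-(d - ε)) : ℝ) : ℂ) * 𝓕 φ x =
      (rieszConst d ε : ℂ) * ∫ p, ((‖p‖ ^ (-ε) : ℝ) : ℂ) * φ p := by
  have hs : 0 < d - ε := by linarith
  have h1 := integral_rpow_mul_integral_gaussian hs
    (𝓕 φ : 𝓢(E, ℂ)).continuous.aestronglyMeasurable
    ((𝓕 φ : 𝓢(E, ℂ)).integrable_norm_rpow_mul (by linarith))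
  have h2 := integral_rpow_mul_integral_gaussian hε φ.continuous.aestronglyMeasurable
    (φ.integrable_norm_rpow_mul (hdE ▸ hd))
  -- The inversion `t ↦ t⁻¹`. Gaussian duality leaves the weight `t^((d-ε)/2-1) t^(-d/2) =
  -- t^(-ε/2-1)`, which is `t^(-2) (t⁻¹)^(ε/2-1)`, Jacobian included.
  have h3 := integral_comp_rpow_Ioi (fun t : ℝ => ((t ^ (ε / 2 - 1) : ℝ) : ℂ) *
        ∫ x, ((Real.exp (-(Real.pi * ‖x‖ ^ 2 * t)) : ℝ) : ℂ) * φ x) (p := -1) (by norm_num)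
  have h4 : ∫ t in Set.Ioi (0 : ℝ), ((t ^ ((d - ε) / 2 - 1) : ℝ) : ℂ) *
        ∫ x, ((Real.exp (-(Real.pi * ‖x‖ ^ 2 * t)) : ℝ) : ℂ) * 𝓕 φ x =
      ((Real.pi ^ (-(ε / 2)) * Real.Gamma (ε / 2) : ℝ) : ℂ) *
        ∫ x, ((‖x‖ ^ (-ε) : ℝ) : ℂ) * φ x := by
    rw [← h2, ← h3]
    refine setIntegral_congr_fun measurableSet_Ioi fun t ht => ?_
    have ht' : (0 : ℝ) < t := ht
    rw [integral_gaussian_mul_fourier φ ht', Real.rpow_neg_one, Complex.real_smul, ← mul_assoc,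
      ← mul_assoc, ← Complex.ofReal_mul, ← Complex.ofReal_mul]
    congr 2
    rw [Real.inv_rpow ht'.le, ← Real.rpow_neg ht'.le, mul_assoc, ← Real.rpow_add ht',
      ← Real.rpow_add ht']
    simp only [abs_neg, abs_one, one_mul]
    congr 1
    rw [hdE]; ring
  rw [h4] at h1
  have hpi := Real.pi_pos
  have hG := Real.Gamma_pos_of_pos (half_pos hs)
  have h5 : Real.pi ^ ((d - ε) / 2) / Real.Gamma ((d - ε) / 2) *
      (Real.pi ^ (-((d - ε) / 2)) * Real.Gamma ((d - ε) / 2)) = 1 := by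
    rw [Real.rpow_neg hpi.le]
    field_simp
  rw [rieszConst, Complex.ofReal_mul, mul_assoc, h1, ← mul_assoc, ← Complex.ofReal_mul, h5,
    Complex.ofReal_one, one_mul]

end Riesz

/-! ### The logarithmic limit of the Riesz formula -/

section LogFormula

variable {E : Type*} [NormedAddCommGroup E] [InnerProductSpace ℝ E]

theorem SchwartzMap.exists_norm_sub_le (f : 𝓢(E, ℂ)) :
    ∃ K, 0 ≤ K ∧ ∀ x, ‖f x - f 0‖ ≤ K * ‖x‖ := by
  refine ⟨SchwartzMap.seminorm ℝ 0 1 f, by positivity, fun x => ?_⟩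
  have := convex_univ.norm_image_sub_le_of_norm_fderiv_le (𝕜 := ℝ) (f := f)
    (C := SchwartzMap.seminorm ℝ 0 1 f) (x := 0) (y := x) (fun y _ => f.differentiableAt)
    (fun y _ => by
      rw [← norm_iteratedFDeriv_one]; exact f.norm_iteratedFDeriv_le_seminorm ℝ 1 y)
    (Set.mem_univ _) (Set.mem_univ _)
  simpa using this

theorem abs_log_le_rpow_add {r : ℝ} (hr : 0 < r) :
    |Real.log r| ≤ 4 * r ^ (-(1 / 4) : ℝ) + r := by
  rcases le_total r 1 with h | h
  · have h1 := Real.abs_log_mul_self_rpow_lt r (1 / 4) hr h (by norm_num)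
    have h2 : 0 < r ^ (1 / 4 : ℝ) := by positivity
    rw [abs_mul, abs_of_pos h2] at h1
    rw [Real.rpow_neg hr.le, ← div_eq_mul_inv]
    have : |Real.log r| ≤ 4 / r ^ (1 / 4 : ℝ) := by
      rw [le_div_iff₀ h2]; linarith
    linarith
  · rw [abs_of_nonneg (Real.log_nonneg h)]
    have := Real.log_le_sub_one_of_pos hr
    have : 0 ≤ r ^ (-(1 / 4) : ℝ) := by positivity
    linarith

theorem abs_exp_sub_one_le_mul (u : ℝ) : |Real.exp u - 1| ≤ |u| * (1 + Real.exp u) := by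
  have h1 := Real.add_one_le_exp u
  have h2 := Real.add_one_le_exp (-u)
  have h3 := Real.exp_pos u
  have h4 : Real.exp u * Real.exp (-u) = 1 := by rw [← Real.exp_add]; simp
  rcases le_total 0 u with h | h
  · rw [abs_of_nonneg h, abs_of_nonneg (by linarith)]
    nlinarith
  · rw [abs_of_nonpos h, abs_of_nonpos (by simpa using h)]
    nlinarith

/-- An `ε`-free majorant, from `|e^u - 1| ≤ |u| (1 + e^u)` at `u = -ε log r`. Its worst singularity
at the origin is `r^(-3/4)`, integrable in every dimension `≥ 1`. -/
theorem abs_inv_mul_rpow_neg_sub_one_le {r ε : ℝ} (hr : 0 < r) (hε : 0 < ε) (hε' : ε < 1 / 2) :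
    |ε⁻¹ * (r ^ (-ε) - 1)| ≤ (4 * r ^ (-(1 / 4) : ℝ) + r) * (2 + r ^ (-(1 / 2) : ℝ)) := by
  have h1 := abs_exp_sub_one_le_mul (Real.log r * (-ε))
  rw [← Real.rpow_def_of_pos hr, abs_mul, abs_neg, abs_of_pos hε] at h1
  have h2 : r ^ (-ε) ≤ 1 + r ^ (-(1 / 2) : ℝ) := by
    rcases le_total r 1 with h | h
    · have := Real.rpow_le_rpow_of_exponent_ge hr h (show (-(1 / 2) : ℝ) ≤ -ε by linarith)
      linarith
    · have := Real.rpow_le_one_of_one_le_of_nonpos h (show -ε ≤ 0 by linarith)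
      have : 0 ≤ r ^ (-(1 / 2) : ℝ) := by positivity
      linarith
  rw [abs_mul, abs_inv, abs_of_pos hε, inv_mul_le_iff₀ hε]
  calc _ ≤ |Real.log r| * ε * (1 + r ^ (-ε)) := h1
    _ ≤ (4 * r ^ (-(1 / 4) : ℝ) + r) * ε * (1 + (1 + r ^ (-(1 / 2) : ℝ))) := by
        gcongr
        exact abs_log_le_rpow_add hr
    _ = _ := by ring

/-- The factor `ε` cancels the pole of the Gamma function: `ε Γ(ε/2) = 2 Γ(ε/2 + 1)`. -/
theorem tendsto_rieszConst_mul {d : ℝ} (hd : 0 < d) :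
    Tendsto (fun ε => rieszConst d ε * ε) (𝓝[>] 0)
      (𝓝 (2 * Real.pi ^ (d / 2) / Real.Gamma (d / 2))) := by
  have hpi := Real.pi_pos
  have hG : ∀ {s : ℝ}, 0 < s → ContinuousAt Real.Gamma s := fun {s} hs =>
    (Real.differentiableAt_Gamma fun m => by
      have : (0 : ℝ) ≤ m := m.cast_nonneg
      linarith).continuousAt
  have hGd := Real.Gamma_pos_of_pos (half_pos hd)
  have hc : ContinuousAt (fun ε : ℝ => Real.pi ^ ((d - ε) / 2) / Real.Gamma ((d - ε) / 2) *
      (Real.pi ^ (-(ε / 2)) * (2 * Real.Gamma (ε / 2 + 1)))) 0 := by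
    have c1 : ContinuousAt (fun ε : ℝ => Real.Gamma ((d - ε) / 2)) 0 :=
      ContinuousAt.comp' (f := fun ε : ℝ => (d - ε) / 2) (by simpa using hG (half_pos hd))
        (by fun_prop)
    have c2 : ContinuousAt (fun ε : ℝ => Real.Gamma (ε / 2 + 1)) 0 :=
      ContinuousAt.comp' (f := fun ε : ℝ => ε / 2 + 1) (by simpa using hG one_pos) (by fun_prop)
    have c3 : ∀ {f : ℝ → ℝ}, Continuous f → ContinuousAt (fun ε => Real.pi ^ f ε) 0 :=
      fun hf => (Real.continuousAt_const_rpow hpi.ne').comp hf.continuousAt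
    refine ((c3 (by fun_prop)).div c1 ?_).mul ((c3 (by fun_prop)).mul (c2.const_mul 2))
    simpa using hGd.ne'
  have h := hc.tendsto.mono_left (nhdsWithin_le_nhds (s := Set.Ioi 0))
  have hval : Real.pi ^ ((d - 0) / 2) / Real.Gamma ((d - 0) / 2) *
      (Real.pi ^ (-((0 : ℝ) / 2)) * (2 * Real.Gamma (0 / 2 + 1))) =
      2 * Real.pi ^ (d / 2) / Real.Gamma (d / 2) := by
    simp; ring
  rw [hval] at h
  refine h.congr' ?_
  filter_upwards [self_mem_nhdsWithin] with ε hε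
  have hε' : (0 : ℝ) < ε := hε
  rw [Real.Gamma_add_one (by positivity), rieszConst]
  ring

variable [FiniteDimensional ℝ E] [MeasurableSpace E] [BorelSpace E] [Nontrivial E]

/-- The singularity of `‖x‖ ^ (-d)` at the origin is compensated by subtracting the value at the
origin on the unit ball. -/
theorem SchwartzMap.exists_norm_sub_indicator_le (f : 𝓢(E, ℂ)) :
    (∃ K, ∀ x, ‖f x - (Metric.ball 0 1).indicator (fun _ => f 0) x‖ ≤ K * ‖x‖) ∧
    Integrable fun x => ((‖x‖ ^ (-(Module.finrank ℝ E : ℝ)) : ℝ) : ℂ) *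
      (f x - (Metric.ball 0 1).indicator (fun _ => f 0) x) := by
  obtain ⟨K₁, hK₁, h₁⟩ := f.exists_norm_sub_le
  obtain ⟨K₂, hK₂, h₂, h₂'⟩ := f.norm_rpow_mul_norm_le 1
  have near : ∀ x : E, ‖x‖ < 1 →
      ‖f x - (Metric.ball 0 1).indicator (fun _ => f 0) x‖ ≤ (K₁ + K₂) * ‖x‖ := by
    intro x hx
    rw [Set.indicator_of_mem (by simpa using hx)]
    nlinarith [h₁ x, norm_nonneg x]
  have far : ∀ x : E, 1 ≤ ‖x‖ →
      ‖f x - (Metric.ball 0 1).indicator (fun _ => f 0) x‖ ≤ (K₁ + K₂) * ‖x‖ ^ (-1 : ℝ) := by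
    intro x hx
    rw [Set.indicator_of_notMem (by simpa using hx), sub_zero]
    refine (h₂' x hx).trans ?_
    gcongr
    linarith
  refine ⟨⟨K₁ + K₂, fun x => ?_⟩, ?_⟩
  · rcases lt_or_ge ‖x‖ 1 with hx | hx
    · exact near x hx
    · refine (far x hx).trans ?_
      gcongr
      exact (Real.rpow_le_one_of_one_le_of_nonpos hx (by norm_num)).trans hx
  · refine integrable_of_norm_le_rpow_of_norm_le_rpow (K := K₁ + K₂)
      (a := Module.finrank ℝ E - 1) (b := Module.finrank ℝ E + 1)
      ((measurable_norm_rpow _).aestronglyMeasurable.mul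
        (f.continuous.aestronglyMeasurable.sub
          (aestronglyMeasurable_const.indicator measurableSet_ball)))
      (by linarith) (by linarith) (fun x hx hx1 => ?_) (fun x hx => ?_)
    · rw [norm_mul, Complex.norm_real, Real.norm_of_nonneg (by positivity)]
      refine (mul_le_mul_of_nonneg_left (near x hx1) (by positivity)).trans_eq ?_
      rw [neg_sub, sub_eq_neg_add, Real.rpow_add hx, Real.rpow_one]
      ring
    · rw [norm_mul, Complex.norm_real, Real.norm_of_nonneg (by positivity)]
      refine (mul_le_mul_of_nonneg_left (far x hx) (by positivity)).trans_eq ?_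
      rw [neg_add, Real.rpow_add (by linarith)]
      ring

/-- Modulo constants, the Fourier transform of `‖x‖ ^ (-d)` is a multiple of `-log ‖p‖`. -/
theorem integral_norm_rpow_neg_finrank_mul_fourier (φ : 𝓢(E, ℂ)) {d : ℝ}
    (hdE : (Module.finrank ℝ E : ℝ) = d) (h0 : ∫ p, φ p = 0) :
    ∫ x, ((‖x‖ ^ (-d) : ℝ) : ℂ) * 𝓕 φ x =
      -((2 * Real.pi ^ (d / 2) / Real.Gamma (d / 2) : ℝ) : ℂ) *
        ∫ p, ((Real.log ‖p‖ : ℝ) : ℂ) * φ p := by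
  have hd1 : 1 ≤ d := by rw [← hdE]; exact_mod_cast (Module.finrank_pos : 0 < Module.finrank ℝ E)
  obtain ⟨ψ, hψ⟩ : ∃ ψ : 𝓢(E, ℂ), ψ = 𝓕 φ := ⟨_, rfl⟩
  have hψ0 : ψ 0 = 0 := by
    rw [hψ, SchwartzMap.fourier_coe, Real.fourier_eq]; simpa using h0
  have hψint : Integrable fun x => ((‖x‖ ^ (-d) : ℝ) : ℂ) * ψ x := by
    simpa [hψ0, hdE] using ψ.exists_norm_sub_indicator_le.2
  have hsmall : ∀ᶠ ε : ℝ in 𝓝[>] 0, 0 < ε ∧ ε < 1 / 2 :=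
    Ioo_mem_nhdsGT (by norm_num)
  have hA : Tendsto (fun ε : ℝ => ∫ x, ((‖x‖ ^ (-(d - ε)) : ℝ) : ℂ) * ψ x) (𝓝[>] 0)
      (𝓝 (∫ x, ((‖x‖ ^ (-d) : ℝ) : ℂ) * ψ x)) := by
    -- For `0 < ε < 1/2` the power is at most its value at `ε = 0` on `‖x‖ ≤ 1` and its value at `ε
    -- = 1/2` on `‖x‖ ≥ 1`; the sum of the two dominates.
    refine tendsto_integral_filter_of_dominated_convergence
      (fun x => ‖((‖x‖ ^ (-d) : ℝ) : ℂ) * ψ x‖ + ‖((‖x‖ ^ (-(d - 1 / 2)) : ℝ) : ℂ) * ψ x‖)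
      (.of_forall fun ε => (measurable_norm_rpow _).aestronglyMeasurable.mul
        ψ.continuous.aestronglyMeasurable) ?_
      (hψint.norm.add (ψ.integrable_norm_rpow_mul (by linarith)).norm) ?_
    · filter_upwards [hsmall] with ε hε
      filter_upwards [Measure.ae_ne volume (0 : E)] with x hx
      have hx' := norm_pos_iff.2 hx
      simp only [norm_mul, Complex.norm_real]
      rw [Real.norm_of_nonneg (by positivity), Real.norm_of_nonneg (by positivity),
        Real.norm_of_nonneg (by positivity), ← add_mul]
      gcongr
      rcases le_total ‖x‖ 1 with h | h
      · have := Real.rpow_le_rpow_of_exponent_ge hx' h (show -d ≤ -(d - ε) by linarith)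
        have : 0 ≤ ‖x‖ ^ (-(d - 1 / 2)) := by positivity
        linarith
      · have := Real.rpow_le_rpow_of_exponent_le h (show -(d - ε) ≤ -(d - 1 / 2) by linarith)
        have : 0 ≤ ‖x‖ ^ (-d) := by positivity
        linarith
    · filter_upwards [Measure.ae_ne volume (0 : E)] with x hx
      have hx' := norm_pos_iff.2 hx
      refine Tendsto.mul_const _ ((Complex.continuous_ofReal.tendsto _).comp ?_)
      have : ContinuousAt (fun ε : ℝ => ‖x‖ ^ (-(d - ε))) 0 :=
        (Real.continuousAt_const_rpow hx'.ne').comp (by fun_prop)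
      simpa using this.tendsto.mono_left (nhdsWithin_le_nhds (s := Set.Ioi 0))
  have hC : Tendsto (fun ε : ℝ => ∫ p, ((ε⁻¹ * (‖p‖ ^ (-ε) - 1) : ℝ) : ℂ) * φ p) (𝓝[>] 0)
      (𝓝 (∫ p, ((-Real.log ‖p‖ : ℝ) : ℂ) * φ p)) := by
    have I : ∀ a : ℝ, a < 1 → Integrable fun x => ‖x‖ ^ (-a) * ‖φ x‖ := by
      intro a ha
      refine (φ.integrable_norm_rpow_mul (a := a) (by linarith)).norm.congr (ae_of_all _ ?_)
      intro x
      simp only [norm_mul, Complex.norm_real]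
      rw [Real.norm_of_nonneg (by positivity)]
    have hbd : Integrable fun x : E => (4 * ‖x‖ ^ (-(1 / 4) : ℝ) + ‖x‖) *
        (2 + ‖x‖ ^ (-(1 / 2) : ℝ)) * ‖φ x‖ := by
      refine (((((I (1 / 4) (by norm_num)).const_mul 8).add
        ((I (3 / 4) (by norm_num)).const_mul 4)).add
        ((I (-1) (by norm_num)).const_mul 2)).add (I (-(1 / 2)) (by norm_num))).congr ?_
      filter_upwards [Measure.ae_ne volume (0 : E)] with x hx
      have hx' := norm_pos_iff.2 hx
      have e1 : ‖x‖ ^ (-(3 / 4) : ℝ) = ‖x‖ ^ (-(1 / 4) : ℝ) * ‖x‖ ^ (-(1 / 2) : ℝ) := by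
        rw [← Real.rpow_add hx']; norm_num
      have e2 : ‖x‖ ^ (-(-(1 / 2)) : ℝ) = ‖x‖ * ‖x‖ ^ (-(1 / 2) : ℝ) := by
        nth_rewrite 2 [← Real.rpow_one ‖x‖]
        rw [← Real.rpow_add hx']; norm_num
      simp only [Pi.add_apply, e1, e2]
      simp only [neg_neg, Real.rpow_one]
      ring
    refine tendsto_integral_filter_of_dominated_convergence _
      (.of_forall fun ε => AEStronglyMeasurable.mul (Measurable.aestronglyMeasurable
        (Complex.measurable_ofReal.comp (by fun_prop))) φ.continuous.aestronglyMeasurable) ?_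
      hbd ?_
    · filter_upwards [hsmall] with ε hε
      filter_upwards [Measure.ae_ne volume (0 : E)] with x hx
      rw [norm_mul, Complex.norm_real]
      gcongr
      exact abs_inv_mul_rpow_neg_sub_one_le (norm_pos_iff.2 hx) hε.1 hε.2
    · filter_upwards [Measure.ae_ne volume (0 : E)] with x hx
      have hx' := norm_pos_iff.2 hx
      refine Tendsto.mul_const _ ((Complex.continuous_ofReal.tendsto _).comp ?_)
      have := tendsto_rpow_sub_one_log (inv_pos.2 hx')
      rw [Real.log_inv] at this
      refine this.congr fun ε => ?_
      rw [Real.inv_rpow hx'.le, Real.rpow_neg hx'.le]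
  have hB := (Complex.continuous_ofReal.tendsto _).comp
    (tendsto_rieszConst_mul (show 0 < d by linarith))
  have hBC := hB.mul hC
  have hlim := tendsto_nhds_unique hA (hBC.congr' ?_)
  · rw [← hψ, hlim, neg_mul, ← mul_neg, ← integral_neg]
    congr 2
    ext p
    push_cast
    ring
  · filter_upwards [hsmall] with ε hε
    have hεc : (ε : ℂ) ≠ 0 := by exact_mod_cast hε.1.ne'
    rw [hψ, integral_norm_rpow_mul_fourier φ hdE hε.1 (by linarith)]
    have hsub : ∫ p, ((ε⁻¹ * (‖p‖ ^ (-ε) - 1) : ℝ) : ℂ) * φ p =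
        (ε : ℂ)⁻¹ * ∫ p, ((‖p‖ ^ (-ε) : ℝ) : ℂ) * φ p := by
      -- Since `φ` has integral zero, `1` may be subtracted from the power at no cost.
      have : ∫ p, ((‖p‖ ^ (-ε) : ℝ) : ℂ) * φ p =
          ∫ p, (((‖p‖ ^ (-ε) : ℝ) : ℂ) * φ p - φ p) := by
        rw [integral_sub (φ.integrable_norm_rpow_mul (by linarith)) φ.integrable, h0, sub_zero]
      rw [this, ← integral_const_mul]
      congr 1
      ext p
      push_cast
      ring
    rw [hsub]
    simp only [Function.comp_apply, Complex.ofReal_mul]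
    field_simp

end LogFormula

/-! ### Scaling limits of functions with a power tail -/

section Scaling

variable {E : Type*} [NormedAddCommGroup E]

theorem tendsto_mul_norm_rpow_of_isEquivalent [ProperSpace E] {G : E → ℂ} {c : ℂ} {s : ℝ}
    (h : G ~[cocompact E] fun y => c * ((‖y‖ ^ (-s) : ℝ) : ℂ)) :
    Tendsto (fun y => G y * ((‖y‖ ^ s : ℝ) : ℂ)) (cocompact E) (𝓝 c) := by
  have h1 := h.mul (IsEquivalent.refl (u := fun y : E => ((‖y‖ ^ s : ℝ) : ℂ)))
  refine h1.symm.tendsto_nhds (tendsto_const_nhds.congr' ?_)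
  filter_upwards [(tendsto_norm_cocompact_atTop (E := E)).eventually_gt_atTop 0] with y hy
  simp only [Pi.mul_apply]
  rw [mul_assoc, ← Complex.ofReal_mul, ← Real.rpow_add hy]
  simp

theorem exists_norm_le_rpow_of_tendsto [ProperSpace E] {G : E → ℂ} {c : ℂ} {s M : ℝ}
    (h : Tendsto (fun y => G y * ((‖y‖ ^ s : ℝ) : ℂ)) (cocompact E) (𝓝 c)) (hM : ‖c‖ < M) :
    ∃ R, 1 ≤ R ∧ ∀ y, R ≤ ‖y‖ → ‖G y‖ ≤ M * ‖y‖ ^ (-s) := by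
  have h1 := h.norm.eventually_lt_const hM
  rw [← Metric.cobounded_eq_cocompact] at h1
  obtain ⟨R, -, hR⟩ := (hasBasis_cobounded_norm (E := E)).eventually_iff.1 h1
  refine ⟨max R 1, le_max_right _ _, fun y hy => ?_⟩
  have hy0 : 0 < ‖y‖ := lt_of_lt_of_le one_pos ((le_max_right _ _).trans hy)
  have h2 := hR ((le_max_left _ _).trans hy : y ∈ {x | R ≤ ‖x‖})
  rw [norm_mul, Complex.norm_real, Real.norm_of_nonneg (by positivity)] at h2
  rw [Real.rpow_neg hy0.le, ← div_eq_mul_inv, le_div_iff₀ (by positivity)]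
  exact h2.le

variable [InnerProductSpace ℝ E]

/-- For fixed `x ≠ 0` the point `l⁻¹ • x` escapes to infinity, and `l^(-s) = ‖l⁻¹ • x‖^s ‖x‖^(-s)`.
-/
theorem tendsto_rpow_mul_comp_inv_smul [ProperSpace E] {G : E → ℂ} {c : ℂ} {s : ℝ}
    (h : Tendsto (fun y => G y * ((‖y‖ ^ s : ℝ) : ℂ)) (cocompact E) (𝓝 c)) {x : E} (hx : x ≠ 0) :
    Tendsto (fun l : ℝ => ((l ^ (-s) : ℝ) : ℂ) * G (l⁻¹ • x)) (𝓝[>] 0)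
      (𝓝 (c * ((‖x‖ ^ (-s) : ℝ) : ℂ))) := by
  have hx' := norm_pos_iff.2 hx
  have ht : Tendsto (fun l : ℝ => l⁻¹ • x) (𝓝[>] 0) (cocompact E) := by
    rw [← Metric.cobounded_eq_cocompact, ← tendsto_norm_atTop_iff_cobounded]
    simp only [norm_smul]
    exact (tendsto_norm_atTop_atTop.comp tendsto_inv_nhdsGT_zero).atTop_mul_const hx'
  refine ((h.comp ht).mul_const ((‖x‖ ^ (-s) : ℝ) : ℂ)).congr' ?_
  filter_upwards [self_mem_nhdsWithin] with l hl
  have hl' : (0 : ℝ) < l := hl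
  simp only [Function.comp_apply, norm_smul, norm_inv, Real.norm_of_nonneg hl'.le]
  rw [mul_assoc, ← Complex.ofReal_mul, Real.mul_rpow (by positivity) hx'.le, mul_assoc,
    ← Real.rpow_add hx', Real.inv_rpow hl'.le, ← Real.rpow_neg hl'.le]
  simp [mul_comm]

variable [FiniteDimensional ℝ E] [MeasurableSpace E] [BorelSpace E] [Nontrivial E]

/-- After `x = l y` the global bound on `G` is scale invariant, so it gives a majorant independent
of `l`, and dominated convergence applies. -/
theorem tendsto_rpow_mul_integral_comp_smul_of_norm_le {G h : E → ℂ} {c : ℂ} {d ε M : ℝ}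
    (hdE : (Module.finrank ℝ E : ℝ) = d) (hG : AEStronglyMeasurable G)
    (hM : ∀ y, y ≠ 0 → ‖G y‖ ≤ M * ‖y‖ ^ (-(d - ε)))
    (htail : Tendsto (fun y => G y * ((‖y‖ ^ (d - ε) : ℝ) : ℂ)) (cocompact E) (𝓝 c))
    (hh : AEStronglyMeasurable h)
    (hint : Integrable fun x => ((‖x‖ ^ (-(d - ε)) : ℝ) : ℂ) * h x) :
    (∀ l : ℝ, 0 < l → Integrable fun y => G y * h (l • y)) ∧
    Tendsto (fun l : ℝ => ((l ^ ε : ℝ) : ℂ) * ∫ y, G y * h (l • y)) (𝓝[>] 0)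
      (𝓝 (c * ∫ x, ((‖x‖ ^ (-(d - ε)) : ℝ) : ℂ) * h x)) := by
  have hGl : ∀ l : ℝ, 0 < l → AEStronglyMeasurable (fun x => G (l⁻¹ • x)) := fun l hl =>
    hG.comp_quasiMeasurePreserving
      (Measure.quasiMeasurePreserving_smul volume (inv_pos.2 hl).ne')
  have hbound : ∀ l : ℝ, 0 < l → ∀ x : E, x ≠ 0 →
      ‖((l ^ (-(d - ε)) : ℝ) : ℂ) * G (l⁻¹ • x) * h x‖ ≤
        M * ‖((‖x‖ ^ (-(d - ε)) : ℝ) : ℂ) * h x‖ := by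
    intro l hl x hx
    have hx' := norm_pos_iff.2 hx
    have h1 := hM (l⁻¹ • x) (by simp [hx, hl.ne'])
    rw [norm_smul, norm_inv, Real.norm_of_nonneg hl.le, Real.mul_rpow (by positivity) hx'.le,
      Real.inv_rpow hl.le] at h1
    simp only [norm_mul, Complex.norm_real]
    rw [Real.norm_of_nonneg (by positivity), Real.norm_of_nonneg (by positivity), ← mul_assoc]
    refine mul_le_mul_of_nonneg_right ?_ (norm_nonneg _)
    have hl0 : 0 < l ^ (-(d - ε)) := by positivity
    calc _ ≤ l ^ (-(d - ε)) * (M * ((l ^ (-(d - ε)))⁻¹ * ‖x‖ ^ (-(d - ε)))) :=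
          mul_le_mul_of_nonneg_left h1 hl0.le
      _ = _ := by field_simp
  have hmeas : ∀ l : ℝ, 0 < l →
      AEStronglyMeasurable fun x => ((l ^ (-(d - ε)) : ℝ) : ℂ) * G (l⁻¹ • x) * h x :=
    fun l hl => ((hGl l hl).const_mul _).mul hh
  constructor
  · intro l hl
    have h1 : Integrable fun x => ((l ^ (-(d - ε)) : ℝ) : ℂ) * G (l⁻¹ • x) * h x := by
      refine (hint.norm.const_mul M).mono' (hmeas l hl) ?_
      filter_upwards [Measure.ae_ne volume (0 : E)] with x hx using hbound l hl x hx
    have h2 := (h1.comp_smul hl.ne').const_mul ((l ^ (d - ε) : ℝ) : ℂ)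
    refine h2.congr (ae_of_all _ fun y => ?_)
    simp only
    rw [smul_smul, inv_mul_cancel₀ hl.ne', one_smul, ← mul_assoc, ← mul_assoc,
      ← Complex.ofReal_mul, ← Real.rpow_add hl]
    simp
  · have hT : Tendsto (fun l : ℝ => ∫ x, ((l ^ (-(d - ε)) : ℝ) : ℂ) * G (l⁻¹ • x) * h x) (𝓝[>] 0)
        (𝓝 (∫ x, c * ((‖x‖ ^ (-(d - ε)) : ℝ) : ℂ) * h x)) := by
      refine tendsto_integral_filter_of_dominated_convergence
        (fun x => M * ‖((‖x‖ ^ (-(d - ε)) : ℝ) : ℂ) * h x‖) ?_ ?_ (hint.norm.const_mul M) ?_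
      · filter_upwards [self_mem_nhdsWithin] with l hl using hmeas l hl
      · filter_upwards [self_mem_nhdsWithin] with l hl
        filter_upwards [Measure.ae_ne volume (0 : E)] with x hx using hbound l hl x hx
      · filter_upwards [Measure.ae_ne volume (0 : E)] with x hx
        exact (tendsto_rpow_mul_comp_inv_smul htail hx).mul_const _
    simp only [mul_assoc c] at hT
    rw [integral_const_mul] at hT
    refine hT.congr' ?_
    filter_upwards [self_mem_nhdsWithin] with l hl
    have hl' : (0 : ℝ) < l := hl
    have h1 := Measure.integral_comp_smul_of_nonneg (volume : Measure E)
      (fun x => G (l⁻¹ • x) * h x) l (hR := hl'.le)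
    simp only [smul_smul, inv_mul_cancel₀ hl'.ne', one_smul] at h1
    rw [h1, Complex.real_smul, ← mul_assoc, ← Complex.ofReal_mul]
    simp only [mul_assoc]
    rw [integral_const_mul]
    congr 2
    rw [← Real.rpow_natCast, hdE, ← Real.rpow_neg hl'.le, ← Real.rpow_add hl']
    congr 1; ring

/-- Scaling limit of a locally integrable function with a power tail, against a function `h` that
vanishes fast enough at the origin. -/
theorem tendsto_rpow_mul_integral_comp_smul {G h : E → ℂ} {c : ℂ} {d ε δ K : ℝ}
    (hdE : (Module.finrank ℝ E : ℝ) = d) (hG : LocallyIntegrable G)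
    (htail : Tendsto (fun y => G y * ((‖y‖ ^ (d - ε) : ℝ) : ℂ)) (cocompact E) (𝓝 c))
    (hδ : 0 ≤ δ) (hεδ : 0 < ε + δ) (hh : AEStronglyMeasurable h)
    (hK : ∀ x, ‖h x‖ ≤ K * ‖x‖ ^ δ)
    (hint : Integrable fun x => ((‖x‖ ^ (-(d - ε)) : ℝ) : ℂ) * h x) :
    (∀ l : ℝ, 0 < l → Integrable fun y => G y * h (l • y)) ∧
    Tendsto (fun l : ℝ => ((l ^ ε : ℝ) : ℂ) * ∫ y, G y * h (l • y)) (𝓝[>] 0)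
      (𝓝 (c * ∫ x, ((‖x‖ ^ (-(d - ε)) : ℝ) : ℂ) * h x)) := by
  obtain ⟨R, hR1, hR⟩ := exists_norm_le_rpow_of_tendsto htail (lt_add_one ‖c‖)
  have hK0 : 0 ≤ K := by
    obtain ⟨x, hx⟩ := exists_norm_eq E (zero_le_one' ℝ)
    simpa [hx] using (norm_nonneg _).trans (hK x)
  -- Outside `B` the tail bound makes the previous lemma applicable. Inside, `G` is integrable and
  -- `‖h (l • y)‖ ≤ K (l R)^δ`, so that part is `O(l^(ε+δ))`.
  set B : Set E := Metric.ball 0 R with hB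
  have hBm : MeasurableSet B := measurableSet_ball
  have hGm := hG.aestronglyMeasurable
  have hGB : Integrable (B.indicator G) := by
    rw [integrable_indicator_iff hBm]
    exact (hG.integrableOn_isCompact (isCompact_closedBall 0 R)).mono_set Metric.ball_subset_closedBall
  have houter := tendsto_rpow_mul_integral_comp_smul_of_norm_le (G := Bᶜ.indicator G) (h := h)
    (c := c) (ε := ε) (M := ‖c‖ + 1) hdE (hGm.indicator hBm.compl)
    (fun y _ => by
      by_cases hy : y ∈ B
      · rw [Set.indicator_of_notMem (by simpa using hy), norm_zero]; positivity
      · rw [Set.indicator_of_mem (by simpa using hy)]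
        exact hR y (by simpa [hB] using hy))
    (htail.congr' (by
      filter_upwards [(tendsto_norm_cocompact_atTop (E := E)).eventually_ge_atTop R] with y hy
      rw [Set.indicator_of_mem]
      simpa [hB] using hy)) hh hint
  have hinner_bound : ∀ l : ℝ, 0 < l → ∀ y,
      ‖B.indicator G y * h (l • y)‖ ≤ K * (l * R) ^ δ * ‖B.indicator G y‖ := by
    intro l hl y
    by_cases hy : y ∈ B
    · rw [norm_mul, mul_comm]
      gcongr
      refine (hK _).trans ?_
      have hy' : ‖y‖ ≤ R := by simpa [hB] using (Metric.mem_ball.1 hy).le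
      rw [norm_smul, Real.norm_of_nonneg hl.le]
      gcongr
    · simp [hy]
  have hinner_int : ∀ l : ℝ, 0 < l → Integrable fun y => B.indicator G y * h (l • y) := by
    intro l hl
    refine (hGB.norm.const_mul (K * (l * R) ^ δ)).mono'
      (hGB.aestronglyMeasurable.mul ?_) (ae_of_all _ (hinner_bound l hl))
    exact hh.comp_quasiMeasurePreserving (Measure.quasiMeasurePreserving_smul volume hl.ne')
  have hinner : Tendsto (fun l : ℝ => ((l ^ ε : ℝ) : ℂ) * ∫ y, B.indicator G y * h (l • y))
      (𝓝[>] 0) (𝓝 0) := by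
    have hz : Tendsto (fun l : ℝ => l ^ (ε + δ) * (K * R ^ δ * ∫ y, ‖B.indicator G y‖))
        (𝓝[>] 0) (𝓝 0) := by
      have : ContinuousAt (fun l : ℝ => l ^ (ε + δ)) 0 :=
        Real.continuousAt_rpow_const _ _ (Or.inr hεδ.le)
      have h2 := this.tendsto.mono_left (nhdsWithin_le_nhds (s := Set.Ioi 0))
      rw [Real.zero_rpow hεδ.ne'] at h2
      simpa using h2.mul_const _
    refine squeeze_zero_norm' ?_ hz
    filter_upwards [self_mem_nhdsWithin] with l hl
    have hl' : (0 : ℝ) < l := hl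
    rw [norm_mul, Complex.norm_real, Real.norm_of_nonneg (by positivity), Real.rpow_add hl',
      mul_assoc]
    gcongr
    refine (norm_integral_le_of_norm_le (hGB.norm.const_mul (K * (l * R) ^ δ))
      (ae_of_all _ (hinner_bound l hl'))).trans_eq ?_
    rw [integral_const_mul, Real.mul_rpow hl'.le (by linarith)]
    ring
  have hsplit : ∀ (l : ℝ) (y : E), G y * h (l • y) =
      B.indicator G y * h (l • y) + Bᶜ.indicator G y * h (l • y) := by
    intro l y
    rw [← add_mul, ← Pi.add_apply (B.indicator G), Set.indicator_self_add_compl]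
  refine ⟨fun l hl => ((hinner_int l hl).add (houter.1 l hl)).congr
    (ae_of_all _ fun y => (hsplit l y).symm), ?_⟩
  have hsum := hinner.add houter.2
  rw [zero_add] at hsum
  refine hsum.congr' ?_
  filter_upwards [self_mem_nhdsWithin] with l hl
  rw [← mul_add, ← integral_add (hinner_int l hl) (houter.1 l hl)]
  simp only [hsplit]

end Scaling

/-! ### Logarithmic growth of integrals over balls -/

section LogGrowth

variable {E : Type*} [NormedAddCommGroup E] [InnerProductSpace ℝ E] [FiniteDimensional ℝ E]
  [MeasurableSpace E] [BorelSpace E]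

theorem integrableOn_ball_indicator_norm_rpow {d : ℝ} (hd : 0 ≤ d) (r : ℝ) :
    IntegrableOn (fun y : E => (Set.Ici 1).indicator (fun t : ℝ => t ^ (-d)) ‖y‖)
      (Metric.ball 0 r) := by
  refine Measure.integrableOn_of_bounded (M := 1) measure_ball_lt_top.ne
    (((measurable_id.pow_const _).indicator measurableSet_Ici).comp
      measurable_norm).aestronglyMeasurable (ae_of_all _ fun y => ?_)
  by_cases h : ‖y‖ ∈ Set.Ici (1 : ℝ)
  · rw [Set.indicator_of_mem h, Real.norm_of_nonneg (by positivity)]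
    exact Real.rpow_le_one_of_one_le_of_nonpos h (by linarith)
  · rw [Set.indicator_of_notMem h]; simp

variable [Nontrivial E]

/-- In polar coordinates the integrand is `1/t` on `[1, r)`; the cutoff at `1` removes the
divergence at the origin. -/
theorem integral_ball_indicator_norm_rpow {d r : ℝ} (hdE : (Module.finrank ℝ E : ℝ) = d)
    (hr : 1 ≤ r) :
    ∫ y in Metric.ball (0 : E) r, (Set.Ici 1).indicator (fun t : ℝ => t ^ (-d)) ‖y‖ =
      d * volume.real (Metric.ball (0 : E) 1) * Real.log r := by
  have hd : 1 ≤ Module.finrank ℝ E := Module.finrank_pos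
  have h1 : ∫ y in Metric.ball (0 : E) r, (Set.Ici 1).indicator (fun t : ℝ => t ^ (-d)) ‖y‖ =
      ∫ y : E, (Set.Ico 1 r).indicator (fun t : ℝ => t ^ (-d)) ‖y‖ := by
    rw [← integral_indicator measurableSet_ball]
    congr 1
    ext y
    simp only [Set.indicator, Metric.mem_ball, dist_zero_right, Set.mem_Ici, Set.mem_Ico]
    split_ifs <;> first | rfl | (exfalso; grind)
  rw [h1, integral_fun_norm_addHaar volume]
  have h2 : ∫ y in Set.Ioi (0 : ℝ), y ^ (Module.finrank ℝ E - 1) •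
      (Set.Ico 1 r).indicator (fun t : ℝ => t ^ (-d)) y = Real.log r := by
    have h3 : ∀ y ∈ Set.Ioi (0 : ℝ), y ^ (Module.finrank ℝ E - 1) •
        (Set.Ico 1 r).indicator (fun t : ℝ => t ^ (-d)) y =
        (Set.Ico 1 r).indicator (fun t : ℝ => t⁻¹) y := by
      intro y hy
      have hy' : (0 : ℝ) < y := hy
      by_cases h : y ∈ Set.Ico 1 r
      · rw [Set.indicator_of_mem h, Set.indicator_of_mem h, smul_eq_mul, ← Real.rpow_natCast,
          ← Real.rpow_add hy', ← Real.rpow_neg_one]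
        congr 1
        push_cast [hd]
        rw [hdE]; ring
      · rw [Set.indicator_of_notMem h, Set.indicator_of_notMem h, smul_zero]
    rw [setIntegral_congr_fun measurableSet_Ioi h3, setIntegral_indicator measurableSet_Ico,
      Set.inter_eq_self_of_subset_right
        (show Set.Ico 1 r ⊆ Set.Ioi 0 from fun y hy => lt_of_lt_of_le one_pos hy.1),
      integral_Ico_eq_integral_Ioo, ← integral_Ioc_eq_integral_Ioo,
      ← intervalIntegral.integral_of_le hr, integral_inv_of_pos one_pos (by linarith), div_one]
  rw [h2, nsmul_eq_mul, smul_eq_mul, hdE]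
  ring

/-- The integral over large balls of a function with tail `c ‖y‖ ^ (-d)` grows logarithmically. -/
theorem tendsto_setIntegral_ball_div_log {G : E → ℂ} {c : ℂ} {d : ℝ}
    (hdE : (Module.finrank ℝ E : ℝ) = d) (hG : LocallyIntegrable G)
    (htail : Tendsto (fun y => G y * ((‖y‖ ^ d : ℝ) : ℂ)) (cocompact E) (𝓝 c)) :
    Tendsto (fun r : ℝ => (∫ y in Metric.ball (0 : E) r, G y) / ((Real.log r : ℝ) : ℂ)) atTop
      (𝓝 (c * ((d * volume.real (Metric.ball (0 : E) 1) : ℝ) : ℂ))) := by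
  have hd0 : 0 ≤ d := hdE ▸ Nat.cast_nonneg _
  set σ := d * volume.real (Metric.ball (0 : E) 1) with hσ
  have hσ0 : 0 ≤ σ := by positivity
  set q : E → ℝ := fun y => (Set.Ici 1).indicator (fun t : ℝ => t ^ (-d)) ‖y‖ with hq
  have hq0 : ∀ y, 0 ≤ q y := fun y => Set.indicator_nonneg (fun t ht => by
    have : (0 : ℝ) < t := lt_of_lt_of_le one_pos ht
    positivity) _
  have hqint := integrableOn_ball_indicator_norm_rpow (E := E) hd0
  have hGint : ∀ r, IntegrableOn G (Metric.ball 0 r) := fun r =>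
    (hG.integrableOn_isCompact (isCompact_closedBall 0 r)).mono_set Metric.ball_subset_closedBall
  -- Subtracting the explicit model `c q` leaves a tail `o(‖y‖^(-d))`, whose integral is `o(log r)`.
  set D : E → ℂ := fun y => G y - c * (q y : ℂ) with hD
  have hDint : ∀ r, IntegrableOn D (Metric.ball 0 r) := fun r =>
    (hGint r).sub ((hqint r).ofReal.const_mul c)
  have hDtail : Tendsto (fun y => D y * ((‖y‖ ^ d : ℝ) : ℂ)) (cocompact E) (𝓝 0) := by
    have h1 := htail.sub_const c
    rw [sub_self] at h1
    refine h1.congr' ?_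
    filter_upwards [(tendsto_norm_cocompact_atTop (E := E)).eventually_ge_atTop 1] with y hy
    have hy0 : 0 < ‖y‖ := by linarith
    simp only [hD, hq]
    rw [Set.indicator_of_mem (show ‖y‖ ∈ Set.Ici (1 : ℝ) from hy), sub_mul, mul_assoc c,
      ← Complex.ofReal_mul, ← Real.rpow_add hy0]
    simp
  have hlog : Tendsto Real.log atTop atTop := Real.tendsto_log_atTop
  have hDo : Tendsto (fun r : ℝ => (∫ y in Metric.ball (0 : E) r, D y) / ((Real.log r : ℝ) : ℂ))
      atTop (𝓝 0) := by
    rw [Metric.tendsto_nhds]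
    intro η hη
    -- With this `M` the region beyond `R` costs at most `(η/2) log r`, as `σ/(σ+1) ≤ 1`; the other
    -- half of `η` absorbs the fixed integral `A` once `log r > 2A/η`.
    obtain ⟨R, hR1, hR⟩ := exists_norm_le_rpow_of_tendsto (M := η / (2 * (σ + 1))) hDtail
      (by rw [norm_zero]; positivity)
    set A := ∫ y in Metric.ball (0 : E) R, ‖D y‖
    filter_upwards [eventually_ge_atTop R, hlog.eventually_gt_atTop 0,
      hlog.eventually_gt_atTop (2 * A / η)] with r hr hr0 hrA
    have hle : ‖∫ y in Metric.ball (0 : E) r, D y‖ ≤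
        A + η / (2 * (σ + 1)) * (σ * Real.log r) := by
      have hA : A = ∫ y in Metric.ball (0 : E) r, (Metric.ball (0 : E) R).indicator
          (fun y => ‖D y‖) y := by
        rw [setIntegral_indicator measurableSet_ball,
          Set.inter_eq_self_of_subset_right (Metric.ball_subset_ball hr)]
      have hi : IntegrableOn (fun y => (Metric.ball (0 : E) R).indicator (fun y => ‖D y‖) y)
          (Metric.ball 0 r) := (hDint r).norm.indicator measurableSet_ball
      rw [hA, hσ, ← integral_ball_indicator_norm_rpow hdE (hR1.trans hr), ← integral_const_mul,
        ← integral_add hi ((hqint r).const_mul _)]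
      refine norm_integral_le_of_norm_le (hi.add ((hqint r).const_mul _))
        (ae_of_all _ fun y => ?_)
      by_cases hy : y ∈ Metric.ball (0 : E) R
      · rw [Set.indicator_of_mem hy]
        have := hq0 y
        have : 0 ≤ η / (2 * (σ + 1)) * q y := by positivity
        simpa [hq] using this
      · have hy' : R ≤ ‖y‖ := by simpa using hy
        rw [Set.indicator_of_notMem hy, zero_add,
          Set.indicator_of_mem (show ‖y‖ ∈ Set.Ici (1 : ℝ) from hR1.trans hy')]
        exact hR y hy'
    rw [dist_zero_right, norm_div, Complex.norm_real, Real.norm_of_nonneg hr0.le,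
      div_lt_iff₀ hr0]
    have h1 : A < η / 2 * Real.log r := by
      rw [div_lt_iff₀ hη] at hrA; linarith
    have h2 : η / (2 * (σ + 1)) * (σ * Real.log r) ≤ η / 2 * Real.log r := by
      rw [← mul_assoc]
      gcongr
      rw [div_mul_eq_mul_div, div_le_div_iff₀ (by positivity) two_pos]
      nlinarith
    linarith
  have hfin := hDo.add_const (c * (σ : ℂ))
  rw [zero_add] at hfin
  refine hfin.congr' ?_
  filter_upwards [eventually_ge_atTop 1, hlog.eventually_gt_atTop 0] with r hr hr0
  have hlogc : ((Real.log r : ℝ) : ℂ) ≠ 0 := by exact_mod_cast hr0.ne'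
  have h1 : ∫ y in Metric.ball (0 : E) r, D y =
      (∫ y in Metric.ball (0 : E) r, G y) - c * ((σ * Real.log r : ℝ) : ℂ) := by
    rw [hσ, ← integral_ball_indicator_norm_rpow hdE hr, ← integral_complex_ofReal,
      ← integral_const_mul]
    exact integral_sub (hGint r) ((hqint r).ofReal.const_mul c)
  rw [h1]
  push_cast
  field_simp
  ring

end LogGrowth

/-! ### Singularities of the Fourier transform at the origin -/

/-- Identifies the constant of the logarithmic growth with that of the log formula, so that both
clauses of `HasLogSingularity` hold with the same `C`. -/
theorem EuclideanSpace.natCast_mul_volume_real_ball {n : ℕ} (hn : 0 < n) :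
    (n : ℝ) * volume.real (Metric.ball (0 : EuclideanSpace ℝ (Fin n)) 1) =
      2 * Real.pi ^ ((n : ℝ) / 2) / Real.Gamma ((n : ℝ) / 2) := by
  have : Nonempty (Fin n) := ⟨⟨0, hn⟩⟩
  have hn' : (0 : ℝ) < n := by exact_mod_cast hn
  have hG := Real.Gamma_pos_of_pos (half_pos hn')
  have hsq : √Real.pi ^ n = Real.pi ^ ((n : ℝ) / 2) := by
    rw [Real.sqrt_eq_rpow, ← Real.rpow_natCast, ← Real.rpow_mul Real.pi_pos.le]
    congr 1; ring
  have hpi := Real.pi_pos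
  rw [Measure.real, EuclideanSpace.volume_ball, Fintype.card_fin, ENNReal.ofReal_one, one_pow,
    one_mul, Real.Gamma_add_one (by positivity), ENNReal.toReal_ofReal (by positivity), hsq]
  field_simp

section Singularities

variable {n : ℕ} {g : EuclideanSpace ℝ (Fin n) → ℂ} {T : 𝓢'(EuclideanSpace ℝ (Fin n), ℂ)}

theorem hasPowerSingularity_fourier {ε : ℝ} (hε : 0 < ε) (hεn : ε < n)
    (hg : LocallyIntegrable g) (htail : HasPowerTail g (n - ε)) (hT : IsRepresentedBy T g) :
    HasPowerSingularity (𝓕 T) ε := by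
  have hn : 0 < n := by exact_mod_cast hε.trans hεn
  have : NeZero n := ⟨hn.ne'⟩
  obtain ⟨c, hc, hgc⟩ := htail
  have hdE : (Module.finrank ℝ (EuclideanSpace ℝ (Fin n)) : ℝ) = n := by simp
  refine ⟨c * (rieszConst n ε : ℂ),
    mul_ne_zero hc (by exact_mod_cast (rieszConst_pos hε hεn).ne'), fun φ => ?_⟩
  obtain ⟨K, -, hK, -⟩ := (𝓕 φ : 𝓢(EuclideanSpace ℝ (Fin n), ℂ)).norm_rpow_mul_norm_le 0
  have h := (tendsto_rpow_mul_integral_comp_smul (δ := 0) (K := K) hdE hg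
    (tendsto_mul_norm_rpow_of_isEquivalent hgc) le_rfl (by linarith)
    (𝓕 φ : 𝓢(EuclideanSpace ℝ (Fin n), ℂ)).continuous.aestronglyMeasurable
    (by simpa using hK)
    ((𝓕 φ : 𝓢(EuclideanSpace ℝ (Fin n), ℂ)).integrable_norm_rpow_mul (by linarith))).2
  rw [integral_norm_rpow_mul_fourier φ hdE hε hεn, ← mul_assoc] at h
  refine h.congr' ?_
  filter_upwards [self_mem_nhdsWithin] with l hl
  rw [rescaled_fourier hT hl]

theorem hasLogSingularity_fourier (hn : 0 < n) (hg : LocallyIntegrable g)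
    (htail : HasPowerTail g n) (hT : IsRepresentedBy T g) : HasLogSingularity (𝓕 T) := by
  have : NeZero n := ⟨hn.ne'⟩
  obtain ⟨c, hc, hgc⟩ := htail
  have hdE : (Module.finrank ℝ (EuclideanSpace ℝ (Fin n)) : ℝ) = n := by simp
  have hσ := EuclideanSpace.natCast_mul_volume_real_ball hn
  have hσ0 : 0 < 2 * Real.pi ^ ((n : ℝ) / 2) / Real.Gamma ((n : ℝ) / 2) := by
    have := Real.Gamma_pos_of_pos (half_pos (Nat.cast_pos (α := ℝ).2 hn))
    have := Real.pi_pos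
    positivity
  set σ := 2 * Real.pi ^ ((n : ℝ) / 2) / Real.Gamma ((n : ℝ) / 2)
  have htend := tendsto_mul_norm_rpow_of_isEquivalent hgc
  -- The scaling limit at `ε = 0`, with `δ = 1` supplied by the subtraction at the origin.
  have hpair : ∀ ψ : 𝓢(EuclideanSpace ℝ (Fin n), ℂ),
      (∀ l : ℝ, 0 < l → Integrable fun y =>
        g y * (ψ (l • y) - (Metric.ball 0 1).indicator (fun _ => ψ 0) (l • y))) ∧
      Tendsto (fun l : ℝ => ∫ y,
        g y * (ψ (l • y) - (Metric.ball 0 1).indicator (fun _ => ψ 0) (l • y))) (𝓝[>] 0)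
        (𝓝 (c * ∫ x, ((‖x‖ ^ (-(n : ℝ)) : ℝ) : ℂ) *
          (ψ x - (Metric.ball 0 1).indicator (fun _ => ψ 0) x))) := by
    intro ψ
    obtain ⟨⟨K, hK⟩, hint⟩ := ψ.exists_norm_sub_indicator_le
    rw [hdE] at hint
    simpa using tendsto_rpow_mul_integral_comp_smul (ε := 0) (δ := 1) (K := K)
      (h := fun x => ψ x - (Metric.ball 0 1).indicator (fun _ => ψ 0) x) hdE hg
      (by simpa using htend) zero_le_one (by norm_num)
      (ψ.continuous.aestronglyMeasurable.sub
        (aestronglyMeasurable_const.indicator measurableSet_ball))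
      (by simpa using hK) (by simpa using hint)
  have hzero : ∀ φ : 𝓢(EuclideanSpace ℝ (Fin n), ℂ), 𝓕 φ 0 = ∫ p, φ p := by
    intro φ
    rw [SchwartzMap.fourier_coe, Real.fourier_eq]; simp
  refine ⟨c * (σ : ℂ), mul_ne_zero hc (by exact_mod_cast hσ0.ne'), fun φ => ?_, fun φ hφ => ?_⟩
  · obtain ⟨ψ, hψ⟩ : ∃ ψ : 𝓢(EuclideanSpace ℝ (Fin n), ℂ), ψ = 𝓕 φ := ⟨_, rfl⟩
    have hloginv : Tendsto (fun l : ℝ => Real.log (1 / l)) (𝓝[>] 0) atTop := by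
      simpa only [one_div, Function.comp_def] using Real.tendsto_log_atTop.comp tendsto_inv_nhdsGT_zero
    have h1 : Tendsto (fun l : ℝ => (∫ y,
        g y * (ψ (l • y) - (Metric.ball 0 1).indicator (fun _ => ψ 0) (l • y))) *
        (((Real.log (1 / l))⁻¹ : ℝ) : ℂ)) (𝓝[>] 0) (𝓝 0) := by
      have := (hpair ψ).2.mul ((Complex.continuous_ofReal.tendsto 0).comp
        (tendsto_inv_atTop_zero.comp hloginv))
      simpa using this
    have h2 := ((tendsto_setIntegral_ball_div_log hdE hg htend).comp
      (tendsto_inv_nhdsGT_zero (𝕜 := ℝ))).const_mul (ψ 0)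
    have h3 := h1.add h2
    have hψ0 : ψ 0 = ∫ p, φ p := by rw [hψ, hzero]
    rw [hσ, zero_add, mul_comm (ψ 0) (c * _)] at h3
    rw [← hψ0]
    refine h3.congr' ?_
    filter_upwards [self_mem_nhdsWithin] with l hl
    have hl' : (0 : ℝ) < l := hl
    -- The unit ball in `l • y` is the ball of radius `l⁻¹` in `y`, which produces the growing
    -- integral of `g`.
    have hball : ∀ y : EuclideanSpace ℝ (Fin n),
        g y * (Metric.ball 0 1).indicator (fun _ => ψ 0) (l • y) =
        ψ 0 * (Metric.ball 0 l⁻¹).indicator g y := by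
      intro y
      have hiff : l • y ∈ Metric.ball (0 : EuclideanSpace ℝ (Fin n)) 1 ↔ y ∈ Metric.ball 0 l⁻¹ := by
        simp only [Metric.mem_ball, dist_zero_right, norm_smul, Real.norm_of_nonneg hl'.le]
        rw [inv_eq_one_div, lt_div_iff₀ hl', mul_comm]
      by_cases hy : y ∈ Metric.ball 0 l⁻¹
      · rw [Set.indicator_of_mem hy, Set.indicator_of_mem (hiff.2 hy), mul_comm]
      · rw [Set.indicator_of_notMem hy, Set.indicator_of_notMem (mt hiff.1 hy)]; simp
    have hgb : Integrable ((Metric.ball 0 l⁻¹).indicator g) := by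
      rw [integrable_indicator_iff measurableSet_ball]
      exact (hg.integrableOn_isCompact (isCompact_closedBall 0 l⁻¹)).mono_set
        Metric.ball_subset_closedBall
    have hsum : ∫ y, g y * ψ (l • y) =
        (∫ y, g y * (ψ (l • y) - (Metric.ball 0 1).indicator (fun _ => ψ 0) (l • y))) +
          ψ 0 * ∫ y in Metric.ball 0 l⁻¹, g y := by
      rw [← integral_indicator measurableSet_ball, ← integral_const_mul,
        ← integral_add ((hpair ψ).1 l hl') (hgb.const_mul _)]
      congr 1
      ext y
      rw [← hball y]; ring
    rw [rescaled_fourier hT hl', ← hψ, hsum]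
    simp only [Function.comp_apply, one_div]
    push_cast
    ring
  · have h := (hpair (𝓕 φ)).2
    -- Here `𝓕 φ 0 = 0`, so the subtracted term vanishes and no division by the logarithm is needed.
    rw [hzero, hφ] at h
    simp only [Set.indicator_zero, sub_zero] at h
    rw [integral_norm_rpow_neg_finrank_mul_fourier φ hdE hφ, ← mul_assoc, mul_neg] at h
    refine h.congr' ?_
    filter_upwards [self_mem_nhdsWithin] with l hl
    rw [rescaled_fourier hT hl]

end Singularities

theorem mainTheorem3 (n : ℕ) (W : EuclideanSpace ℝ (Fin n) → ℂ) (αinf : ℝ)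
    (hinf : IsAlphaInf W αinf) (α ε : ℝ) (hε : αinf - α = ε) (hεn : ε < n)
    (htail : HasPowerTail (dampedG W α) (n - ε)) :
    (0 < ε → ∃ T : 𝓢'(EuclideanSpace ℝ (Fin n), ℂ),
      IsRepresentedBy T (dampedG W α) ∧ HasPowerSingularity (𝓕 T) ε) ∧
    (α = αinf → ∃ T : 𝓢'(EuclideanSpace ℝ (Fin n), ℂ),
      IsRepresentedBy T (dampedG W α) ∧ HasLogSingularity (𝓕 T)) := by
  -- Any exponent above the threshold would do.
  have hint := hinf.1 (αinf + 1) (lt_add_one _)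
  obtain ⟨T, hT⟩ := exists_isRepresentedBy_dampedG hint α
  have hloc := locallyIntegrable_dampedG hint α
  refine ⟨fun hpos => ⟨T, hT, hasPowerSingularity_fourier hpos hεn hloc htail hT⟩,
    fun hα => ⟨T, hT, ?_⟩⟩
  obtain rfl : ε = 0 := by rw [← hε, hα, sub_self]
  rw [sub_zero] at htail
  exact hasLogSingularity_fourier (by exact_mod_cast hεn) hloc htail hT
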